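/- Let $G$ be a finite group. Let $\mathrm{Irr}(G)$ be the set of irreducible complex characters of $G$, let $\mathrm{cd}(G)=\{\chi(1) : \chi\in\mathrm{Irr}(G)\}$ be the set of character degrees of $G$, and let $\rho(G)$ be the set of primes that divide some element of $\mathrm{cd}(G)$. The prime graph $\Delta(G)$ is the simple graph with vertex set $\rho(G)$ in which two distinct primes $p,q\in\rho(G)$ are adjacent if and only if $pq$ divides some $a\in\mathrm{cd}(G)$. Suppose that $\Delta(G)$ is isomorphic to the prism graph on six vertices $p_1,\dots,p_6$, whose edges are those of the two triangles $\{p_1,p_2,p_3\}$ and $\{p_4,p_5,p_6\}$ together with the three edges $\{p_i,p_{i+3}\}$ for $1\le i\le 3$. Then $G'=G''$, where $G'=[G,G]$ and $G''=[G',G']$. In particular, $G$ is not solvable. -/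

import Mathlib

namespace CharacterPrimeGraph

/-- `Irr(G)`: the set of irreducible complex characters of `G`, as functions `G → ℂ`. Every
finite-dimensional complex representation is isomorphic to one on some `ℂⁿ`, so only these
spaces are used. -/
def Irr (G : Type*) [Group G] : Set (G → ℂ) :=
  {χ | ∃ (n : ℕ) (φ : Representation ℂ G (Fin n → ℂ)), φ.IsIrreducible ∧ φ.character = χ}

/-- `cd(G) = {χ(1) | χ ∈ Irr(G)}`: the set of character degrees of `G`. -/
def cd (G : Type*) [Group G] : Set ℕ :=
  {a | ∃ χ ∈ Irr G, χ 1 = (a : ℂ)}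

/-- `ρ(G)`: the set of primes dividing some character degree of `G`. -/
def rho (G : Type*) [Group G] : Set ℕ :=
  {p | p.Prime ∧ ∃ a ∈ cd G, p ∣ a}

/-- `Δ(G)`: the graph on `ρ(G)` in which distinct primes `p` and `q` are adjacent if and only if
`p * q` divides some character degree of `G`. -/
def primeGraph (G : Type*) [Group G] : SimpleGraph (rho G) where
  Adj p q := p ≠ q ∧ ∃ a ∈ cd G, (p : ℕ) * (q : ℕ) ∣ a
  symm := ⟨fun _ _ ⟨hne, a, ha, hd⟩ => ⟨hne.symm, a, ha, by rwa [mul_comm]⟩⟩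
  loopless := ⟨fun _ h => h.1 rfl⟩

/-- The prism graph: two triangles `{0, 1, 2}` and `{3, 4, 5}`, joined by the three edges
`{i, i + 3}`. -/
def prismGraph : SimpleGraph (Fin 6) :=
  SimpleGraph.fromEdgeSet
    {s(0, 1), s(0, 2), s(1, 2), s(3, 4), s(3, 5), s(4, 5), s(0, 3), s(1, 4), s(2, 5)}

end CharacterPrimeGraph

/-! Suppose `G' ≠ G''`. Among the subgroups containing `G'`, take `B` maximal with a linear
character that is not `G`-invariant, and replace the character by its `r`-part `l` for a suitable
prime `r`. A linear character invariant under an element `y` extends to `B⟨y⟩`, so by maximality `l`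
is moved by some element of order `q` modulo `B`, for every prime `q` dividing `|G : B|`
(`exists_linear_character_moved_of_prime_dvd_index`).

Fix a prime `p` dividing `|G : B|`, and let `q ≠ p` be a prime dividing a degree `a` prime to `r`.
If `q` divides `|G : B|`, a degree over `l` is divisible by `pq`. Otherwise an irreducible
constituent `σ` of the restriction to `B` of a representation of degree `a` has dimension divisible
by `q` and prime to `r`. Comparing determinants, `σ` and `σ ⊗ l` are not both invariant under an
element of order `p` modulo `B` that moves `l`. Clifford theory for abelian quotients
(`IsIrreducible.exists_dvd_index_finrank_eq_mul`, `IsIrreducible.mul_finrank_dvd`) then gives a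
degree divisible by `pq`. So `q` is adjacent to `p` in both cases.

Hence every edge with an end outside the closed neighbourhood of `p` comes only from degrees
divisible by `r`, and so lies in the closed neighbourhood of `r`. In the prism no two vertices `p`,
`r` have this property. Finally, a solvable `G` with `G' = G''` is abelian, and then `ρ(G)` is
empty. -/

open Module

/-! ### Invariant subspaces, Maschke's theorem and Schur's lemma -/

namespace Representation

section

variable {k G V : Type*} [Field k] [Group G] [AddCommGroup V] [Module k V]

/-- A representation is irreducible iff its space is nontrivial and has no proper nonzero invariant
subspace. -/
theorem isIrreducible_iff_forall_submodule (ρ : Representation k G V) :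
    ρ.IsIrreducible ↔ Nontrivial V ∧
      ∀ U : Submodule k V, (∀ g, ∀ v ∈ U, ρ g v ∈ U) → U = ⊥ ∨ U = ⊤ := by
  constructor
  · intro h
    refine ⟨?_, fun U hU => ?_⟩
    · by_contra hV
      rw [not_nontrivial_iff_subsingleton] at hV
      apply h.exists_pair_ne.elim
      rintro a ⟨b, hab⟩
      exact hab (Subrepresentation.toSubmodule_injective (Subsingleton.elim _ _))
    · rcases h.eq_bot_or_eq_top (⟨U, fun g v hv => hU g v hv⟩ : Subrepresentation ρ) with h | h
      · left; exact congrArg Subrepresentation.toSubmodule h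
      · right; exact congrArg Subrepresentation.toSubmodule h
  · rintro ⟨hV, h⟩
    refine { exists_pair_ne := ⟨⊥, ⊤, fun e => ?_⟩, eq_bot_or_eq_top := fun U => ?_ }
    · exact bot_ne_top (α := Submodule k V) (congrArg Subrepresentation.toSubmodule e)
    · rcases h U.toSubmodule (fun g v hv => U.apply_mem_toSubmodule g hv) with h | h
      · left; exact Subrepresentation.toSubmodule_injective h
      · right; exact Subrepresentation.toSubmodule_injective h

theorem IsIrreducible.nontrivial {ρ : Representation k G V} (h : ρ.IsIrreducible) : Nontrivial V :=
  ((isIrreducible_iff_forall_submodule ρ).1 h).1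

theorem IsIrreducible.eq_bot_or_eq_top_of_invariant {ρ : Representation k G V}
    (h : ρ.IsIrreducible) {U : Submodule k V} (hU : ∀ g, ∀ v ∈ U, ρ g v ∈ U) : U = ⊥ ∨ U = ⊤ :=
  ((isIrreducible_iff_forall_submodule ρ).1 h).2 U hU

theorem IsIrreducible.eq_top_of_invariant {ρ : Representation k G V}
    (h : ρ.IsIrreducible) {U : Submodule k V} (hU : ∀ g, ∀ v ∈ U, ρ g v ∈ U) (h0 : U ≠ ⊥) :
    U = ⊤ :=
  (h.eq_bot_or_eq_top_of_invariant hU).resolve_left h0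

/-- The restriction of a representation to an invariant subspace. -/
def onInvariant (ρ : Representation k G V) (U : Submodule k V)
    (hU : ∀ g, ∀ v ∈ U, ρ g v ∈ U) : Representation k G U where
  toFun g := (ρ g).restrict (hU g)
  map_one' := by ext; simp
  map_mul' x y := by ext; simp

@[simp]
theorem coe_onInvariant_apply (ρ : Representation k G V) (U : Submodule k V)
    (hU : ∀ g, ∀ v ∈ U, ρ g v ∈ U) (g : G) (u : U) : (ρ.onInvariant U hU g u : V) = ρ g u := rfl

theorem onInvariant_isIrreducible (ρ : Representation k G V) {U : Submodule k V}
    (hU : ∀ g, ∀ v ∈ U, ρ g v ∈ U) (h0 : U ≠ ⊥)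
    (hmin : ∀ U' : Submodule k V, (∀ g, ∀ v ∈ U', ρ g v ∈ U') → U' ≠ ⊥ → U' ≤ U → U' = U) :
    (ρ.onInvariant U hU).IsIrreducible := by
  rw [isIrreducible_iff_forall_submodule]
  refine ⟨Submodule.nontrivial_iff_ne_bot.2 h0, fun X hX => ?_⟩
  by_cases hX0 : X = ⊥
  · exact Or.inl hX0
  · right
    have := hmin (X.map U.subtype) ?_ ?_ (Submodule.map_subtype_le U X)
    · rw [eq_top_iff]
      rintro ⟨x, hx⟩ -
      have hx' := hx
      rw [← this] at hx'
      obtain ⟨y, hy, e⟩ := hx'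
      have hyx : y = ⟨x, hx⟩ := Subtype.ext e
      exact hyx ▸ hy
    · rintro g _ ⟨y, hy, rfl⟩
      exact ⟨_, hX g y hy, rfl⟩
    · rw [Ne, ← Submodule.map_bot U.subtype]
      exact fun e => hX0 (Submodule.map_injective_of_injective U.injective_subtype e)

/-- Maschke: every invariant subspace has an equivariant projection. -/
theorem exists_equivariant_projection [Finite G] [CharZero k] (ρ : Representation k G V)
    {U : Submodule k V} (hU : ∀ g, ∀ v ∈ U, ρ g v ∈ U) :
    ∃ π : V →ₗ[k] V, (∀ g v, π (ρ g v) = ρ g (π v)) ∧ (∀ v, π v ∈ U) ∧ ∀ v ∈ U, π v = v := by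
  have : Fintype G := Fintype.ofFinite G
  obtain ⟨P, hP⟩ := Submodule.exists_isCompl U
  let π₀ : V →ₗ[k] V := U.subtype ∘ₗ U.projectionOnto P hP
  have h1 : ∀ v, π₀ v ∈ U := fun v => Subtype.property _
  have h2 : ∀ v ∈ U, π₀ v = v := fun v hv => by
    simpa [π₀] using congrArg Subtype.val (Submodule.projectionOnto_apply_left hP ⟨v, hv⟩)
  have hc : (Fintype.card G : k) ≠ 0 := Nat.cast_ne_zero.2 Fintype.card_ne_zero
  refine ⟨(Fintype.card G : k)⁻¹ • ∑ x : G, ρ x * π₀ * ρ x⁻¹, fun g v => ?_, fun v => ?_,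
    fun v hv => ?_⟩
  · simp only [LinearMap.smul_apply, LinearMap.sum_apply, Module.End.mul_apply, map_smul, map_sum]
    congr 1
    refine Fintype.sum_equiv (Equiv.mulLeft g⁻¹) _ _ fun x => ?_
    simp only [Equiv.coe_mulLeft, ← Module.End.mul_apply, ← map_mul, ← mul_assoc, mul_inv_rev,
      inv_inv]
    simp [mul_assoc]
  · simp only [LinearMap.smul_apply, LinearMap.sum_apply]
    exact U.smul_mem _ (U.sum_mem fun x _ => hU x _ (h1 _))
  · simp only [LinearMap.smul_apply, LinearMap.sum_apply, Module.End.mul_apply]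
    rw [Finset.sum_congr rfl fun x _ => by rw [h2 _ (hU x⁻¹ v hv)]]
    simp [← Module.End.mul_apply, ← map_mul, ← Nat.cast_smul_eq_nsmul k, smul_smul, hc]

variable [FiniteDimensional k V]

/-- Every nonzero finite-dimensional invariant subspace contains an irreducible one. -/
theorem exists_irreducible_le (ρ : Representation k G V) {Y : Submodule k V}
    (hY : ∀ g, ∀ v ∈ Y, ρ g v ∈ Y) (h0 : Y ≠ ⊥) :
    ∃ (U : Submodule k V) (hU : ∀ g, ∀ v ∈ U, ρ g v ∈ U), U ≤ Y ∧
      (ρ.onInvariant U hU).IsIrreducible := by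
  obtain ⟨U, ⟨hU, hU0, hUY⟩, hmin⟩ := WellFounded.has_min (wellFounded_lt (α := Submodule k V))
    {U | (∀ g, ∀ v ∈ U, ρ g v ∈ U) ∧ U ≠ ⊥ ∧ U ≤ Y} ⟨Y, hY, h0, le_rfl⟩
  refine ⟨U, hU, hUY, ρ.onInvariant_isIrreducible hU hU0 fun U' h1 h2 h3 => ?_⟩
  by_contra hne
  exact hmin U' ⟨h1, h2, h3.trans hUY⟩ (lt_of_le_of_ne h3 hne)

/-- A nonzero linear map out of a finite-dimensional representation is nonzero on some irreducible
subrepresentation, which moreover is an equivariant retract. -/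
theorem exists_irreducible_not_le_ker [Finite G] [CharZero k] (ρ : Representation k G V)
    {W : Type*} [AddCommGroup W] [Module k W] {f : V →ₗ[k] W} (hf : f ≠ 0) :
    ∃ (U : Submodule k V) (hU : ∀ g, ∀ v ∈ U, ρ g v ∈ U),
      (ρ.onInvariant U hU).IsIrreducible ∧ f ∘ₗ U.subtype ≠ 0 ∧
      ∃ π : V →ₗ[k] U, π ≠ 0 ∧ ∀ g v, π (ρ g v) = ρ.onInvariant U hU g (π v) := by
  -- `U` is minimal among invariant subspaces not killed by `f`. If it had a proper nonzero
  -- invariant subspace, that subspace and its Maschke complement in `U` would both be killed by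
  -- `f`, and hence so would `U`.
  obtain ⟨U, ⟨hU, hUf⟩, hmin⟩ := WellFounded.has_min (wellFounded_lt (α := Submodule k V))
    {U | (∀ g, ∀ v ∈ U, ρ g v ∈ U) ∧ ¬ U ≤ LinearMap.ker f}
    ⟨⊤, by simp, by rwa [top_le_iff, LinearMap.ker_eq_top]⟩
  have hU0 : U ≠ ⊥ := by rintro rfl; exact hUf bot_le
  refine ⟨U, hU, ρ.onInvariant_isIrreducible hU hU0 fun U' h1 h2 h3 => ?_, ?_, ?_⟩
  · by_contra hne
    obtain ⟨π, hπ, hπU, hπ1⟩ := ρ.exists_equivariant_projection h1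
    have hker : U' ≤ LinearMap.ker f := by
      by_contra h
      exact hmin U' ⟨h1, h⟩ (lt_of_le_of_ne h3 hne)
    have hlt : U ⊓ LinearMap.ker π < U := by
      refine lt_of_le_of_ne inf_le_left fun e => h2 ?_
      rw [eq_bot_iff]
      intro v hv
      have : v ∈ LinearMap.ker π := (inf_eq_left.1 e) (h3 hv)
      rw [LinearMap.mem_ker, hπ1 v hv] at this
      simp [this]
    apply hmin (U ⊓ LinearMap.ker π) ⟨?_, ?_⟩ hlt
    · rintro g v ⟨hv, hv'⟩
      refine ⟨hU g v hv, ?_⟩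
      simp only [SetLike.mem_coe, LinearMap.mem_ker] at hv' ⊢
      rw [hπ, hv', map_zero]
    · intro hle
      apply hUf
      intro v hv
      have h4 : v - π v ∈ U ⊓ LinearMap.ker π :=
        ⟨U.sub_mem hv (h3 (hπU v)), by simp [hπ1 _ (hπU v)]⟩
      have := Submodule.add_mem _ (hle h4) (hker (hπU v))
      simpa using this
  · intro h
    apply hUf
    intro v hv
    exact LinearMap.congr_fun h ⟨v, hv⟩
  · obtain ⟨π, hπ, hπU, hπ1⟩ := ρ.exists_equivariant_projection hU
    refine ⟨π.codRestrict U hπU, fun h => hU0 ?_, fun g v => Subtype.ext (hπ g v)⟩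
    rw [eq_bot_iff]
    intro v hv
    have := congrArg Subtype.val (LinearMap.congr_fun h v)
    simp only [LinearMap.codRestrict_apply, LinearMap.zero_apply, ZeroMemClass.coe_zero] at this
    rw [hπ1 v hv] at this
    simp [this]

/-- Pairwise commuting operators of a representation over an algebraically closed field have a
common eigenvector in every nonzero invariant subspace. -/
theorem exists_common_eigenvector [IsAlgClosed k] (ρ : Representation k G V)
    (hcomm : ∀ g h, ρ g * ρ h = ρ h * ρ g) {Y : Submodule k V}
    (hY : ∀ g, ∀ v ∈ Y, ρ g v ∈ Y) (h0 : Y ≠ ⊥) :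
    ∃ v ∈ Y, v ≠ 0 ∧ ∀ g, ∃ c : k, ρ g v = c • v := by
  obtain ⟨U, hU, hUY, hirr⟩ := ρ.exists_irreducible_le hY h0
  have := hirr.nontrivial
  obtain ⟨u, hu⟩ := exists_ne (0 : U)
  refine ⟨u, hUY u.2, by simpa using hu, fun g => ?_⟩
  obtain ⟨c, hc⟩ := Module.End.exists_eigenvalue (ρ.onInvariant U hU g)
  refine ⟨c, ?_⟩
  have h1 : Module.End.eigenspace (ρ.onInvariant U hU g) c = ⊤ := by
    refine hirr.eq_top_of_invariant (fun h v hv => ?_) hc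
    rw [Module.End.mem_eigenspace_iff] at hv ⊢
    rw [← map_smul, ← hv]
    exact Subtype.ext (LinearMap.congr_fun (hcomm g h) v)
  have h2 : u ∈ Module.End.eigenspace (ρ.onInvariant U hU g) c := h1 ▸ Submodule.mem_top
  exact congrArg Subtype.val (Module.End.mem_eigenspace_iff.1 h2)

/-- Schur's lemma. -/
theorem IsIrreducible.exists_eq_smul_of_commute [IsAlgClosed k] {ρ : Representation k G V}
    (h : ρ.IsIrreducible) {φ : Module.End k V} (hφ : ∀ g v, φ (ρ g v) = ρ g (φ v)) :
    ∃ c : k, ∀ v, φ v = c • v := by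
  have := h.nontrivial
  obtain ⟨c, hc⟩ := Module.End.exists_eigenvalue φ
  refine ⟨c, fun v => ?_⟩
  have h1 : Module.End.eigenspace φ c = ⊤ := by
    refine h.eq_top_of_invariant (fun g v hv => ?_) hc
    rw [Module.End.mem_eigenspace_iff] at hv ⊢
    rw [hφ, hv, map_smul]
  exact Module.End.mem_eigenspace_iff.1 (h1 ▸ Submodule.mem_top)

end

end Representation

/-! ### Dimension bounds and semi-invariant operators -/

namespace Representation

section

variable {k V : Type*} [Field k] [AddCommGroup V] [Module k V] [FiniteDimensional k V]

theorem _root_.Submodule.finrank_le_sum_of_iSup_eq_top {ι : Type*} [Fintype ι]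
    {U : ι → Submodule k V} (h : ⨆ i, U i = ⊤) : finrank k V ≤ ∑ i, finrank k (U i) := by
  classical
  have h1 : Function.Surjective (DFinsupp.lsum ℕ fun i => (U i).subtype) := by
    rw [← LinearMap.range_eq_top, ← Submodule.iSup_eq_range_dfinsupp_lsum, h]
  exact (LinearMap.finrank_le_finrank_of_surjective h1).trans_eq
    (finrank_directSum k fun i => U i)

theorem _root_.iSupIndep.sum_finrank_le {ι : Type*} [Fintype ι]
    {U : ι → Submodule k V} (h : iSupIndep U) : ∑ i, finrank k (U i) ≤ finrank k V := by
  classical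
  exact (finrank_directSum k fun i => U i).symm.trans_le
    (LinearMap.finrank_le_finrank_of_injective h.dfinsupp_lsum_injective)

variable {G : Type*} [Group G]

/-- A subspace spans an irreducible representation under the group, so a subspace stable under a
subgroup has at least the dimension of the whole space divided by the index. -/
theorem IsIrreducible.finrank_le_index_mul [Finite G] {ρ : Representation k G V}
    (h : ρ.IsIrreducible) (M : Subgroup G) {U : Submodule k V} (hU : ∀ g ∈ M, ∀ v ∈ U, ρ g v ∈ U)
    (h0 : U ≠ ⊥) : finrank k V ≤ M.index * finrank k U := by
  have : Fintype (G ⧸ M) := Fintype.ofFinite _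
  have hmem : ∀ (g : G), ∀ u ∈ U, ρ g u ∈ ⨆ q : G ⧸ M, U.map (ρ q.out) := by
    intro g u hu
    obtain ⟨m, hm⟩ := QuotientGroup.mk_out_eq_mul M g
    refine Submodule.mem_iSup_of_mem (g : G ⧸ M) ⟨ρ (m : G)⁻¹ u, hU _ (M.inv_mem m.2) u hu, ?_⟩
    rw [hm, ← Module.End.mul_apply, ← map_mul, mul_inv_cancel_right]
  have htop : ⨆ q : G ⧸ M, U.map (ρ q.out) = ⊤ := by
    refine h.eq_top_of_invariant (fun g v hv => ?_) fun e => h0 ?_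
    · refine Submodule.iSup_induction _ (motive := fun v => ρ g v ∈ ⨆ q : G ⧸ M, U.map (ρ q.out))
        hv ?_ (by simp) fun x y hx hy => by rw [map_add]; exact Submodule.add_mem _ hx hy
      rintro q _ ⟨u, hu, rfl⟩
      rw [← Module.End.mul_apply, ← map_mul]
      exact hmem _ u hu
    · rw [eq_bot_iff, ← e]
      intro u hu
      simpa using hmem 1 u hu
  refine (Submodule.finrank_le_sum_of_iSup_eq_top htop).trans ?_
  refine (Finset.sum_le_sum fun q _ => Submodule.finrank_map_le (ρ q.out) U).trans ?_
  simp [Subgroup.index, Nat.card_eq_fintype_card]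

end

section

variable {k : Type*} [Field k] [IsAlgClosed k] [CharZero k]

/-- If the restriction of an irreducible representation to a normal subgroup with abelian quotient
is reducible, then some nonzero operator commutes with the subgroup and is conjugated by the group
through a nontrivial linear character. -/
theorem IsIrreducible.exists_semiinvariant {G : Type*} [Group G] [Finite G] {V : Type*}
    [AddCommGroup V] [Module k V] [FiniteDimensional k V] {ρ : Representation k G V}
    (h : ρ.IsIrreducible) {K : Subgroup G} (hK : commutator G ≤ K) {U : Submodule k V}
    (hU : ∀ g ∈ K, ∀ v ∈ U, ρ g v ∈ U) (h0 : U ≠ ⊥) (h1 : U ≠ ⊤) :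
    ∃ (φ : Module.End k V) (μ : G →* k), φ ≠ 0 ∧ (∀ g v, ρ g (φ v) = μ g • φ (ρ g v)) ∧
      (∀ g ∈ K, μ g = 1) ∧ ∃ g, μ g ≠ 1 := by
  have hV := h.nontrivial
  -- the conjugation representation on endomorphisms
  let C : Representation k G (Module.End k V) :=
    { toFun := fun g => LinearMap.mulLeft k (ρ g) * LinearMap.mulRight k (ρ g⁻¹)
      map_one' := by ext; simp
      map_mul' := fun a b => by ext; simp }
  have hC : ∀ g φ, C g φ = ρ g * φ * ρ g⁻¹ := fun g φ => by simp [C, mul_assoc]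
  -- trace zero operators commuting with `K`
  let Y : Submodule k (Module.End k V) :=
    { carrier := {φ | (∀ g ∈ K, C g φ = φ) ∧ LinearMap.trace k V φ = 0}
      add_mem' := fun {a b} ha hb => ⟨fun g hg => by rw [map_add, ha.1 g hg, hb.1 g hg],
        by rw [map_add, ha.2, hb.2, add_zero]⟩
      zero_mem' := by simp
      smul_mem' := fun c a ha => ⟨fun g hg => by rw [map_smul, ha.1 g hg],
        by rw [map_smul, ha.2, smul_zero]⟩ }
  have hKn : ∀ x ∈ K, ∀ g, g⁻¹ * x * g ∈ K := fun x hx g => by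
    have := K.mul_mem (hK (Subgroup.commutator_mem_commutator (Subgroup.mem_top g⁻¹)
      (Subgroup.mem_top x))) hx
    simpa [commutatorElement_def, mul_assoc] using this
  have hY : ∀ g, ∀ φ ∈ Y, C g φ ∈ Y := by
    rintro g φ ⟨h2, h3⟩
    refine ⟨fun x hx => ?_, ?_⟩
    · have := h2 _ (hKn x hx g)
      rw [← Module.End.mul_apply, ← map_mul]
      calc C (x * g) φ = C (g * (g⁻¹ * x * g)) φ := by congr 2; group
        _ = C g (C (g⁻¹ * x * g) φ) := by rw [map_mul, Module.End.mul_apply]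
        _ = _ := by rw [this]
    · rw [hC, LinearMap.trace_mul_comm, ← mul_assoc, ← map_mul]
      simpa using h3
  -- it is nonzero by Maschke
  have hY0 : Y ≠ ⊥ := by
    obtain ⟨π, hπ, hπU, hπ1⟩ := exists_equivariant_projection (ρ.comp K.subtype) (U := U)
      fun g v hv => hU g g.2 v hv
    intro e
    have hd : (finrank k V : k) ≠ 0 := Nat.cast_ne_zero.2 finrank_pos.ne'
    -- The trace-free part of the projection `π` onto `U`. Were it zero, `π` would be a scalar,
    -- equal to `1` because `π` fixes `U ≠ 0`, which forces `U = V`.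
    have hmem : π - (LinearMap.trace k V π / finrank k V) • 1 ∈ Y := by
      refine ⟨fun g hg => ?_, ?_⟩
      · rw [map_sub, map_smul, hC, hC]
        congr 1
        · have : π * ρ g⁻¹ = ρ g⁻¹ * π := LinearMap.ext fun v => hπ (⟨g, hg⟩⁻¹ : K) v
          rw [mul_assoc, this, ← mul_assoc, ← map_mul]
          simp
        · rw [mul_one, ← map_mul]
          simp
      · rw [map_sub, map_smul, LinearMap.trace_one, smul_eq_mul, div_mul_cancel₀ _ hd, sub_self]
    rw [e, Submodule.mem_bot, sub_eq_zero] at hmem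
    set c := LinearMap.trace k V π / finrank k V
    obtain ⟨u, hu, hu0⟩ := Submodule.exists_mem_ne_zero_of_ne_bot h0
    have hc : c = 1 := by
      have h2 := hπ1 u hu
      rw [hmem] at h2
      have h3 : (c - 1) • u = 0 := by rw [sub_smul, one_smul, sub_eq_zero]; simpa using h2
      exact sub_eq_zero.1 ((smul_eq_zero.1 h3).resolve_right hu0)
    apply h1
    rw [eq_top_iff]
    intro v _
    have := hπU v
    rwa [hmem, hc, one_smul] at this
  -- the operators by which `G` acts on it commute
  let D : Representation k G Y := C.onInvariant Y hY
  have hDcomm : ∀ a b, D a * D b = D b * D a := by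
    intro a b
    refine LinearMap.ext fun φ => Subtype.ext ?_
    have h2 : a⁻¹ * b⁻¹ * a * b ∈ K := by
      simpa [commutatorElement_def] using hK (Subgroup.commutator_mem_commutator
        (Subgroup.mem_top a⁻¹) (Subgroup.mem_top b⁻¹))
    have h3 := φ.2.1 _ h2
    change C a (C b φ) = C b (C a φ)
    rw [← Module.End.mul_apply, ← Module.End.mul_apply, ← map_mul, ← map_mul]
    calc C (a * b) φ = C (b * a * (a⁻¹ * b⁻¹ * a * b)) φ := by congr 2; group
      _ = C (b * a) (C (a⁻¹ * b⁻¹ * a * b) φ) := by rw [map_mul _ (b * a), Module.End.mul_apply]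
      _ = _ := by rw [h3]
  have hYt : (⊤ : Submodule k Y) ≠ ⊥ := by
    have := Submodule.nontrivial_iff_ne_bot.2 hY0
    exact top_ne_bot
  obtain ⟨⟨φ, hφ⟩, -, hφ0, hev⟩ := D.exists_common_eigenvector hDcomm (Y := ⊤) (by simp) hYt
  have hφ0 : φ ≠ 0 := by simpa using hφ0
  choose μ hμ using hev
  have hμ : ∀ g, C g φ = μ g • φ := fun g => congrArg Subtype.val (hμ g)
  have hinj : ∀ {a b : k}, a • φ = b • φ → a = b := fun {a b} e => by
    rw [← sub_eq_zero, ← sub_smul] at e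
    exact sub_eq_zero.1 ((smul_eq_zero.1 e).resolve_right hφ0)
  let μ' : G →* k :=
    { toFun := μ
      map_one' := hinj (by rw [← hμ, map_one, one_smul, Module.End.one_apply])
      map_mul' := fun a b => hinj (by
        rw [← hμ, map_mul, Module.End.mul_apply, hμ, map_smul, hμ, smul_smul, mul_comm]) }
  have hrel : ∀ g v, ρ g (φ v) = μ g • φ (ρ g v) := fun g v => by
    have := LinearMap.congr_fun (hμ g) (ρ g v)
    simpa [hC, ← Module.End.mul_apply (ρ g⁻¹), ← map_mul] using this
  refine ⟨φ, μ', hφ0, hrel, fun g hg => hinj ?_, ?_⟩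
  · change μ g • φ = _
    rw [← hμ, hφ.1 g hg, one_smul]
  -- If `μ` were trivial, `φ` would commute with `G` and be a scalar by Schur; a scalar of trace
  -- zero is zero in characteristic zero.
  · by_contra! hall
    obtain ⟨c, hc⟩ := h.exists_eq_smul_of_commute (φ := φ) fun g v => by
      rw [hrel, show μ g = 1 from hall g, one_smul]
    have hφc : φ = c • 1 := LinearMap.ext fun v => by simp [hc]
    have := hφ.2
    rw [hφc, map_smul, LinearMap.trace_one, smul_eq_mul] at this
    rcases mul_eq_zero.1 this with h2 | h2
    · exact hφ0 (by rw [hφc, h2, zero_smul])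
    · exact Nat.cast_ne_zero.2 finrank_pos.ne' h2

end

end Representation

/-! ### Clifford theory over a subgroup with abelian quotient -/

namespace Representation

section

universe u v

variable {k : Type*} [Field k]

/-- Every irreducible representation of a subgroup lies under an irreducible representation of the
group. -/
theorem IsIrreducible.exists_over {G : Type u} [Group G] [Finite G] {B : Subgroup G} {W : Type v}
    [AddCommGroup W] [Module k W] [FiniteDimensional k W] {σ : Representation k B W}
    (hσ : σ.IsIrreducible) :
    ∃ (V : Submodule k (G → W)) (ρ : Representation k G V) (f : V →ₗ[k] W),
      ρ.IsIrreducible ∧ f ≠ 0 ∧ ∀ (x : B) v, f (ρ x v) = σ x (f v) := by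
  classical
  let C : Representation k G (G → W) :=
    { toFun := fun g => LinearMap.funLeft k W (· * g)
      map_one' := by ext; simp [LinearMap.funLeft]
      map_mul' := fun a b => by ext; simp [LinearMap.funLeft, mul_assoc] }
  have hC : ∀ g F x, C g F x = F (x * g) := fun g F x => rfl
  -- The representation induced from `σ`, as the `B`-equivariant functions under right translation.
  let Y : Submodule k (G → W) :=
    { carrier := {F | ∀ (b : B) x, F (b * x) = σ b (F x)}
      add_mem' := fun ha hb b x => by simp [ha b x, hb b x]
      zero_mem' := by simp
      smul_mem' := fun c F hF b x => by simp [hF b x] }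
  have hY : ∀ g, ∀ F ∈ Y, C g F ∈ Y := fun g F hF b x => by
    rw [hC, hC, mul_assoc]
    exact hF b _
  have := hσ.nontrivial
  obtain ⟨w, hw⟩ := exists_ne (0 : W)
  have hY0 : Y ≠ ⊥ := by
    intro e
    have hmem : (fun x => if hx : x ∈ B then σ ⟨x, hx⟩ w else 0) ∈ Y := by
      intro b x
      by_cases hx : x ∈ B
      · simp only [hx, B.mul_mem b.2 hx, dif_pos]
        rw [← Module.End.mul_apply, ← map_mul]
        rfl
      · simp [hx, B.mul_mem_cancel_left b.2]
    rw [e, Submodule.mem_bot] at hmem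
    have := congrFun hmem 1
    simp only [B.one_mem, dif_pos] at this
    exact hw (by simpa [show (⟨1, B.one_mem⟩ : B) = 1 from rfl] using this)
  obtain ⟨V, hV, hVY, hirr⟩ := C.exists_irreducible_le hY hY0
  -- The map to `W` is evaluation at `1`. If it vanished on `V`, then so would evaluation at every
  -- `x`, since `V` is stable under translation.
  refine ⟨V, C.onInvariant V hV, LinearMap.proj 1 ∘ₗ V.subtype, hirr, fun e => ?_, fun b v => ?_⟩
  · refine Submodule.nontrivial_iff_ne_bot.1 hirr.nontrivial ((Submodule.eq_bot_iff _).2 ?_)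
    intro F hF
    funext x
    have := LinearMap.congr_fun e ⟨_, hV x F hF⟩
    simpa [hC] using this
  · have := hVY v.2 b 1
    simpa [hC] using this

variable [IsAlgClosed k] [CharZero k]

-- Each `g` carries the `c`-eigenspace of `φ` into the one for `(μ g)⁻¹ * c`. As `c ≠ 0`, distinct
-- cosets of `μ.ker` give distinct eigenvalues, so the translates of the eigenspace are independent
-- and its dimension times the index is at most `dim V`. The opposite bound `finrank_le_index_mul`
-- holds for every nonzero `μ.ker`-stable subspace; applied inside the eigenspace it yields
-- irreducibility.
omit [IsAlgClosed k] in
theorem IsIrreducible.finrank_eq_index_ker_mul {G : Type*} [Group G] [Finite G] {V : Type*}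
    [AddCommGroup V] [Module k V] [FiniteDimensional k V] {ρ : Representation k G V}
    (h : ρ.IsIrreducible) {φ : Module.End k V} {μ : G →* k}
    (hφ : ∀ g v, ρ g (φ v) = μ g • φ (ρ g v)) (hφ0 : φ ≠ 0) {c : k}
    (hc : φ.eigenspace c ≠ ⊥) (hM : ∀ g : μ.ker, ∀ v ∈ φ.eigenspace c, ρ g v ∈ φ.eigenspace c) :
    (onInvariant (ρ.comp μ.ker.subtype) (φ.eigenspace c) hM).IsIrreducible ∧
      finrank k V = μ.ker.index * finrank k (φ.eigenspace c) := by
  have : Fintype (G ⧸ μ.ker) := Fintype.ofFinite _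
  have hμ0 : ∀ g, μ g ≠ 0 := fun g e => by
    have := map_mul μ g g⁻¹
    simp [e] at this
  have hc0 : c ≠ 0 := by
    rintro rfl
    have h1 : φ.eigenspace 0 = ⊤ := by
      refine h.eq_top_of_invariant (fun g v hv => ?_) hc
      rw [Module.End.mem_eigenspace_iff, zero_smul] at hv ⊢
      have := hφ g v
      rw [hv, map_zero] at this
      exact (smul_eq_zero.1 this.symm).resolve_left (hμ0 g)
    exact hφ0 (LinearMap.ext fun v =>
      (Module.End.mem_eigenspace_iff.1 (h1 ▸ Submodule.mem_top (x := v))).trans (zero_smul k v))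
  have hmap : ∀ g : G, (φ.eigenspace c).map (ρ g) ≤ φ.eigenspace ((μ g)⁻¹ * c) := by
    rintro g _ ⟨v, hv, rfl⟩
    rw [SetLike.mem_coe, Module.End.mem_eigenspace_iff] at hv
    have := hφ g v
    rw [hv, map_smul] at this
    rw [Module.End.mem_eigenspace_iff, mul_smul, this, smul_smul, inv_mul_cancel₀ (hμ0 g), one_smul]
  have hinj : Function.Injective fun q : G ⧸ μ.ker => (μ q.out)⁻¹ * c := by
    intro q q' e
    have e1 : μ q.out = μ q'.out := inv_injective (mul_right_cancel₀ hc0 e)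
    rw [← q.out_eq', ← q'.out_eq']
    refine QuotientGroup.eq.2 ?_
    rw [MonoidHom.mem_ker, map_mul, ← e1, ← map_mul, inv_mul_cancel, map_one]
  have hle : μ.ker.index * finrank k (φ.eigenspace c) ≤ finrank k V := by
    refine le_trans ?_ (iSupIndep.sum_finrank_le
      ((Module.End.eigenspaces_iSupIndep φ).comp hinj))
    rw [Subgroup.index, Nat.card_eq_fintype_card, ← smul_eq_mul, ← Finset.card_univ]
    refine Finset.card_nsmul_le_sum _ _ _ fun q _ => ?_
    have hρ : Function.Injective (ρ q.out) := fun a b e => by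
      have := congrArg (ρ q.out⁻¹) e
      simpa [← Module.End.mul_apply, ← map_mul] using this
    rw [(Submodule.equivMapOfInjective _ hρ _).finrank_eq]
    exact Submodule.finrank_mono (hmap q.out)
  refine ⟨onInvariant_isIrreducible _ hM hc fun U hU hU0 hUle => ?_,
    le_antisymm (h.finrank_le_index_mul _ (fun g hg => hM ⟨g, hg⟩) hc) hle⟩
  have := hle.trans (h.finrank_le_index_mul μ.ker (fun g hg => hU ⟨g, hg⟩) hU0)
  exact Submodule.eq_of_le_of_finrank_le hUle
    (Nat.le_of_mul_le_mul_left this (Nat.pos_of_ne_zero Subgroup.index_ne_zero_of_finite))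

/-- If `K` has normal image with abelian quotient in `G`, an irreducible representation of `G`
lying over an irreducible representation of `K` has degree a multiple of it by a divisor of the
index. -/
theorem IsIrreducible.exists_dvd_index_finrank_eq_mul {K : Type*} [Group K] {W : Type*}
    [AddCommGroup W] [Module k W] {σ : Representation k K W} (hσ : σ.IsIrreducible)
    {G : Type u} [Group G] [Finite G] (i : K →* G) (hK : commutator G ≤ i.range)
    {V : Type v} [AddCommGroup V] [Module k V] [FiniteDimensional k V] {ρ : Representation k G V}
    (hρ : ρ.IsIrreducible) {f : V →ₗ[k] W} (hf : f ≠ 0)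
    (hfi : ∀ x v, f (ρ (i x) v) = σ x (f v)) :
    ∃ m, m ∣ i.range.index ∧ finrank k V = m * finrank k W := by
  -- If `f` is injective, then `V ≅ W`. Otherwise `ker f` makes the restriction reducible, and a
  -- semi-invariant operator `φ` with character `μ` allows descent to the proper subgroup `μ.ker`
  -- acting on an eigenspace of `φ`, which divides the degree by exactly `|G : ker μ|`.
  induction hn : Nat.card G using Nat.strong_induction_on generalizing G V with
  | _ n ih =>
  subst hn
  by_cases hker : LinearMap.ker f = ⊥
  · refine ⟨1, one_dvd _, ?_⟩
    have hr : LinearMap.range f = ⊤ := by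
      refine hσ.eq_top_of_invariant ?_ (mt LinearMap.range_eq_bot.1 hf)
      rintro x _ ⟨v, rfl⟩
      exact ⟨_, hfi x v⟩
    rw [one_mul]
    exact (LinearEquiv.ofBijective f
      ⟨LinearMap.ker_eq_bot.1 hker, LinearMap.range_eq_top.1 hr⟩).finrank_eq
  · obtain ⟨φ, μ, hφ0, hφ, hμK, g₀, hg₀⟩ := hρ.exists_semiinvariant hK (U := LinearMap.ker f)
      (by rintro _ ⟨x, rfl⟩ v hv
          rw [LinearMap.mem_ker] at hv ⊢
          rw [hfi, hv, map_zero]) hker (mt LinearMap.ker_eq_top.1 hf)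
    have := hρ.nontrivial
    have hμ0 : ∀ g, μ g ≠ 0 := fun g e => by
      have := map_mul μ g g⁻¹
      simp [e] at this
    have hmap : ∀ g c, ∀ v ∈ φ.eigenspace c, ρ g v ∈ φ.eigenspace ((μ g)⁻¹ * c) := by
      intro g c v hv
      rw [Module.End.mem_eigenspace_iff] at hv
      have := hφ g v
      rw [hv, map_smul] at this
      rw [Module.End.mem_eigenspace_iff, mul_smul, this, smul_smul, inv_mul_cancel₀ (hμ0 g),
        one_smul]
    -- The group permutes the eigenspaces, so their sum is invariant. As they span `V`, one of them
    -- is not killed by `f`.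
    have htop : ⨆ c, φ.eigenspace c = ⊤ := by
      refine hρ.eq_top_of_invariant (fun g v hv => ?_) fun e => ?_
      · refine Submodule.iSup_induction _ (motive := fun v => ρ g v ∈ ⨆ c, φ.eigenspace c)
          hv (fun c v hv => Submodule.mem_iSup_of_mem _ (hmap g c v hv)) (by simp)
          fun x y hx hy => by rw [map_add]; exact Submodule.add_mem _ hx hy
      · obtain ⟨c, hc⟩ := Module.End.exists_eigenvalue φ
        exact hc (iSup_eq_bot.1 e c)
    obtain ⟨c, hc⟩ : ∃ c, ¬ φ.eigenspace c ≤ LinearMap.ker f := by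
      by_contra! h
      exact hf (LinearMap.ker_eq_top.1 (top_le_iff.1 (htop ▸ iSup_le h)))
    have hM : ∀ g : μ.ker, ∀ v ∈ φ.eigenspace c, ρ g v ∈ φ.eigenspace c := fun g v hv => by
      simpa [show μ g = 1 from g.2] using hmap g c v hv
    obtain ⟨hirr, hdim⟩ := hρ.finrank_eq_index_ker_mul hφ hφ0
      (fun e => hc (e ▸ bot_le)) hM
    have hi : ∀ x, i x ∈ μ.ker := fun x => hμK _ ⟨x, rfl⟩
    have hrange : (i.codRestrict μ.ker hi).range = i.range.subgroupOf μ.ker := by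
      ext x
      simp [MonoidHom.mem_range, Subgroup.mem_subgroupOf, Subtype.ext_iff]
    have hcard : Nat.card μ.ker < Nat.card G := by
      refine lt_of_le_of_ne (Subgroup.card_le_card_group _) fun e => hg₀ ?_
      rw [Subgroup.card_eq_iff_eq_top] at e
      exact (e ▸ Subgroup.mem_top g₀ : g₀ ∈ μ.ker)
    have hcomm : commutator μ.ker ≤ (i.codRestrict μ.ker hi).range := by
      rw [hrange, commutator_def, Subgroup.commutator_le]
      intro a _ b _
      rw [Subgroup.mem_subgroupOf]
      exact hK (Subgroup.commutator_mem_commutator (Subgroup.mem_top (a : G))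
        (Subgroup.mem_top (b : G)))
    have hfc : f ∘ₗ (φ.eigenspace c).subtype ≠ 0 := fun e =>
      hc fun v hv => LinearMap.congr_fun e ⟨v, hv⟩
    obtain ⟨m, hm, hmd⟩ := ih _ hcard (i.codRestrict μ.ker hi) hcomm hirr hfc
      (fun x v => hfi x v) rfl
    refine ⟨μ.ker.index * m, ?_, by rw [hdim, hmd, mul_assoc]⟩
    rw [hrange] at hm
    rw [← Subgroup.relIndex_mul_index (show i.range ≤ μ.ker by rintro _ ⟨x, rfl⟩; exact hi x),
      mul_comm]
    exact mul_dvd_mul_right hm _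

/-- If `W` is an irreducible representation of a normal subgroup `B` with abelian quotient, not
invariant under some `s` with `s ^ q ∈ B`, then irreducible representations over `W` have degree
divisible by `q * dim W`. -/
theorem IsIrreducible.mul_finrank_dvd {G : Type u} [Group G] [Finite G] {B : Subgroup G}
    (hB : commutator G ≤ B) {W : Type*} [AddCommGroup W] [Module k W] [FiniteDimensional k W]
    {σ : Representation k B W} (hσ : σ.IsIrreducible) {q : ℕ} (hq : q.Prime) {s : G}
    (hs : s ^ q ∈ B) {s' : B → B} (hs' : ∀ b, (s' b : G) = s * b * s⁻¹)
    (hinv : ∀ T : W ≃ₗ[k] W, ∃ b w, T (σ b w) ≠ σ (s' b) (T w))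
    {V : Type v} [AddCommGroup V] [Module k V] [FiniteDimensional k V] {ρ : Representation k G V}
    (hρ : ρ.IsIrreducible) {f : V →ₗ[k] W} (hf : f ≠ 0)
    (hfi : ∀ (x : B) v, f (ρ x v) = σ x (f v)) : q * finrank k W ∣ finrank k V := by
  have hBn : B.Normal := ⟨fun x hx g => by
    have := B.mul_mem (hB (Subgroup.commutator_mem_commutator (Subgroup.mem_top g)
      (Subgroup.mem_top x))) hx
    simpa [commutatorElement_def, mul_assoc] using this⟩
  -- `S = B⟨s⟩` has index `1` or `q` over `B`. The factor `q` is gained in passing from `B` to `S`;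
  -- passing from `S` to `G` only multiplies the degree further.
  let S : Subgroup G := (Subgroup.zpowers (s : G ⧸ B)).comap (QuotientGroup.mk' B)
  have hBS : B ≤ S := fun b hb => by
    simp [S, (QuotientGroup.eq_one_iff b).2 hb]
  have hsS : s ∈ S := by simp [S]
  have hcard : B.relIndex S ∣ q := by
    have h1 : (⊥ : Subgroup (G ⧸ B)).comap (QuotientGroup.mk' B) = B := by
      rw [MonoidHom.comap_bot, QuotientGroup.ker_mk']
    have h2 : B.relIndex S = Nat.card (Subgroup.zpowers (s : G ⧸ B)) := by
      conv_lhs => rw [← h1]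
      rw [Subgroup.relIndex_comap, Subgroup.map_comap_eq_self_of_surjective
        (QuotientGroup.mk'_surjective B), Subgroup.relIndex_bot_left]
    rw [h2, Nat.card_zpowers]
    exact orderOf_dvd_of_pow_eq_one (by rwa [← QuotientGroup.mk_pow, QuotientGroup.eq_one_iff])
  have hcomm : ∀ H : Subgroup G, commutator H ≤ B.subgroupOf H := fun H => by
    rw [commutator_def, Subgroup.commutator_le]
    intro a _ b _
    exact hB (Subgroup.commutator_mem_commutator (Subgroup.mem_top (a : G))
        (Subgroup.mem_top (b : G)))
  obtain ⟨X, hX, hXirr, hfX, π, hπ0, hπ⟩ :=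
    exists_irreducible_not_le_ker (ρ.comp S.subtype) hf
  have hrange : (Subgroup.inclusion hBS).range = B.subgroupOf S := Subgroup.inclusion_range hBS
  obtain ⟨m, hm, hXd⟩ := hσ.exists_dvd_index_finrank_eq_mul (Subgroup.inclusion hBS)
    (hrange ▸ hcomm S) hXirr hfX (fun x v => hfi x v)
  obtain ⟨m', -, hVd⟩ := hXirr.exists_dvd_index_finrank_eq_mul S.subtype
    (by rw [S.range_subtype]; exact hB.trans hBS) hρ hπ0 hπ
  rw [hVd, hXd]
  refine Dvd.dvd.mul_left (mul_dvd_mul_right ?_ _) _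
  rw [hrange] at hm
  -- If `m = 1`, then `f` identifies `X` with `W` over `B`, and the action of `s` on `X` becomes an
  -- isomorphism of `W` with its conjugate, against `hinv`.
  rcases (Nat.dvd_prime hq).1 (hm.trans hcard) with rfl | rfl
  · exfalso
    rw [one_mul] at hXd
    have hr : LinearMap.range (f ∘ₗ X.subtype) = ⊤ := by
      refine hσ.eq_top_of_invariant ?_ (mt LinearMap.range_eq_bot.1 hfX)
      rintro x _ ⟨v, rfl⟩
      exact ⟨onInvariant (ρ.comp S.subtype) X hX ⟨x, hBS x.2⟩ v, hfi x v⟩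
    have hsurj := LinearMap.range_eq_top.1 hr
    let e : X ≃ₗ[k] W := LinearEquiv.ofBijective (f ∘ₗ X.subtype)
      ⟨(LinearMap.injective_iff_surjective_of_finrank_eq_finrank hXd).2 hsurj, hsurj⟩
    have he : ∀ x : X, e x = f x := fun x => rfl
    let R : X ≃ₗ[k] X := LinearEquiv.ofBijective
      (onInvariant (ρ.comp S.subtype) X hX ⟨s, hsS⟩) (by
        have hinj : Function.Injective (onInvariant (ρ.comp S.subtype) X hX ⟨s, hsS⟩) :=
          fun a b e => by
            have := congrArg (onInvariant (ρ.comp S.subtype) X hX ⟨s, hsS⟩⁻¹) e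
            rwa [← Module.End.mul_apply, ← Module.End.mul_apply, ← map_mul, inv_mul_cancel,
              map_one] at this
        exact ⟨hinj, LinearMap.injective_iff_surjective.1 hinj⟩)
    obtain ⟨b, w, hbw⟩ := hinv (e.symm.trans (R.trans e))
    apply hbw
    obtain ⟨x, rfl⟩ := e.surjective w
    have hb : ∀ (b : B) (x : X), σ b (e x) = e ⟨ρ b x, hX ⟨b, hBS b.2⟩ x x.2⟩ := fun b x =>
      (hfi b x).symm
    rw [hb]
    simp only [LinearEquiv.trans_apply, LinearEquiv.symm_apply_apply]
    rw [hb]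
    congr 1
    apply Subtype.ext
    change ρ s (ρ b x) = ρ (s' b) (ρ s x)
    rw [← Module.End.mul_apply, ← Module.End.mul_apply, ← map_mul, ← map_mul, hs']
    simp
  · exact dvd_rfl

end

end Representation

/-! ### Linear characters of subgroups containing the derived subgroup -/

section GroupTheory

open scoped commutatorElement

variable {G : Type*} [Group G]

/-- A subgroup generated by a subgroup central modulo `D` and one more element is abelian
modulo `D`. -/
theorem Subgroup.commutator_sup_zpowers_le (D A : Subgroup G) [D.Normal]
    (hA : ∀ g : G, ∀ a ∈ A, ⁅g, a⁆ ∈ D) (y : G) :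
    ⁅A ⊔ Subgroup.zpowers y, A ⊔ Subgroup.zpowers y⁆ ≤ D := by
  let π := QuotientGroup.mk' D
  have hπ : ∀ g a : G, ⁅g, a⁆ ∈ D ↔ π g * π a = π a * π g := fun g a => by
    rw [← commutatorElement_eq_one_iff_mul_comm, ← map_commutatorElement]
    exact (QuotientGroup.eq_one_iff _).symm
  have h1 : A ⊔ zpowers y ≤ (centralizer {π y}).comap π :=
    sup_le (fun a ha => mem_centralizer_singleton_iff.2 ((hπ _ _).1 (hA y a ha)).symm)
      (by rw [zpowers_le]; exact mem_centralizer_singleton_iff.2 rfl)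
  have h2 : A ⊔ zpowers y ≤ (centralizer ((A ⊔ zpowers y).map π : Set (G ⧸ D))).comap π := by
    refine sup_le (fun a ha => ?_) ?_
    · rw [mem_comap, mem_centralizer_iff]
      rintro _ ⟨b, -, rfl⟩
      exact (hπ _ _).1 (hA b a ha)
    · rw [zpowers_le, mem_comap, mem_centralizer_iff]
      rintro _ ⟨b, hb, rfl⟩
      exact mem_centralizer_singleton_iff.1 (h1 hb)
  rw [Subgroup.commutator_le]
  intro a ha b hb
  exact (hπ _ _).2 (mem_centralizer_iff.1 (h2 hb) _ ⟨a, ha, rfl⟩)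

/-- An invariant linear character of a subgroup with cyclic quotient extends. -/
theorem MonoidHom.exists_extension_of_sup_zpowers_eq_top [Finite G] {A : Subgroup G} {t : G}
    (ht : A ⊔ Subgroup.zpowers t = ⊤) (l : A →* ℂˣ)
    (hl : ∀ g : G, ∀ b : A, ∃ b' : A, (b' : G) = g * b * g⁻¹ ∧ l b' = l b) :
    ∃ L : G →* ℂˣ, ∀ a : A, L a = l a := by
  -- By invariance `ker l` is normal in `G` and `A` is central modulo it. Since `G/A` is cyclic,
  -- `G/ker l` is abelian, so `l` factors through the image of `A` in the abelianization of `G`,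
  -- where characters of subgroups extend.
  let D : Subgroup G := l.ker.map A.subtype
  have hD : D.Normal := ⟨by
    rintro _ ⟨a, ha, rfl⟩ g
    obtain ⟨a', h1, h2⟩ := hl g a
    exact ⟨a', by rwa [SetLike.mem_coe, MonoidHom.mem_ker, h2], h1⟩⟩
  have hAD : ∀ g : G, ∀ a ∈ A, ⁅g, a⁆ ∈ D := by
    intro g a ha
    obtain ⟨a', h1, h2⟩ := hl g ⟨a, ha⟩
    refine ⟨a' * ⟨a, ha⟩⁻¹, ?_, ?_⟩
    · rw [SetLike.mem_coe, MonoidHom.mem_ker, map_mul, map_inv, h2, mul_inv_cancel]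
    · simp [h1, commutatorElement_def]
  have hcomm : commutator G ≤ D := by
    have := Subgroup.commutator_sup_zpowers_le D A hAD t
    rwa [ht] at this
  let P := (Abelianization.of (G := G)).subgroupMap A
  have hP : Function.Surjective P := MonoidHom.subgroupMap_surjective _ _
  have hker : P.ker ≤ l.ker := by
    intro a ha
    have h1 : (a : G) ∈ commutator G := by
      rw [← Abelianization.ker_of, MonoidHom.mem_ker]
      exact congrArg Subtype.val ha
    obtain ⟨a', h2, h3⟩ := hcomm h1
    rwa [← show a' = a from Subtype.ext h3]
  let l' := P.liftOfSurjective hP ⟨l, hker⟩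
  have hl' : ∀ a, l' (P a) = l a := fun a => by
    simp [l', MonoidHom.liftOfSurjective, MonoidHom.liftOfRightInverse_comp_apply]
  obtain ⟨L, hL⟩ := MonoidHom.domRestrict_surjective (M := ℂ) (A.map Abelianization.of) l'
  refine ⟨L.comp Abelianization.of, fun a => ?_⟩
  rw [← hl' a, ← hL]
  rfl

/-- If `⁅t, b⁆` is not in the derived subgroup of `B`, some linear character of `B` is moved
by `t`. -/
theorem Subgroup.exists_linear_character_ne [Finite G] {B : Subgroup G} {b b' : B}
    (h : ((b' * b⁻¹ : B) : G) ∉ ⁅B, B⁆) : ∃ l : B →* ℂˣ, l b' ≠ l b := by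
  have h1 : Abelianization.of (b' * b⁻¹) ≠ 1 := by
    intro e
    apply h
    rw [← Subgroup.map_subtype_commutator]
    refine ⟨b' * b⁻¹, ?_, rfl⟩
    rw [SetLike.mem_coe, ← Abelianization.ker_of]
    exact e
  obtain ⟨φ, hφ⟩ := CommGroup.exists_apply_ne_one_of_hasEnoughRootsOfUnity _ ℂ h1
  refine ⟨φ.comp Abelianization.of, fun e => hφ ?_⟩
  rw [map_mul, map_inv, map_mul, map_inv, mul_inv_eq_one]
  exact e

theorem Subgroup.conj_mem_of_commutator_le {B : Subgroup G} (hB : _root_.commutator G ≤ B) (g : G)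
    {b : G} (hb : b ∈ B) : g * b * g⁻¹ ∈ B := by
  have := B.mul_mem (hB (Subgroup.commutator_mem_commutator (Subgroup.mem_top g)
    (Subgroup.mem_top b))) hb
  simpa [commutatorElement_def, mul_assoc] using this

/-- If the derived subgroup is not perfect, then some subgroup containing it has a linear character
that is not invariant. -/
theorem exists_moved_linear_character [Finite G]
    (hG : commutator G ≠ ⁅commutator G, commutator G⁆) :
    ∃ B : Subgroup G, commutator G ≤ B ∧
      ∃ (l : B →* ℂˣ) (t : G) (b b' : B), (b' : G) = t * b * t⁻¹ ∧ l b' ≠ l b := by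
  suffices ∃ B : Subgroup G, commutator G ≤ B ∧ ⁅B, B⁆ ≤ ⁅commutator G, commutator G⁆ ∧
      ∃ t : G, ∃ b ∈ B, ⁅t, b⁆ ∉ ⁅commutator G, commutator G⁆ by
    obtain ⟨B, hB, hBD, t, b, hb, htb⟩ := this
    obtain ⟨l, hl⟩ := Subgroup.exists_linear_character_ne (B := B) (b := ⟨b, hb⟩)
      (b' := ⟨_, Subgroup.conj_mem_of_commutator_le hB t hb⟩) fun h => htb (hBD (by simpa [commutatorElement_def] using h))
    exact ⟨B, hB, l, t, _, _, rfl, hl⟩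
  -- If `G'/G''` is not central in `G/G''`, take `B = G'`. If it is central, take `B = G'⟨y⟩` with
  -- `y` not central modulo `G''`; this is abelian modulo `G''`.
  by_cases h : ∃ t : G, ∃ b ∈ commutator G, ⁅t, b⁆ ∉ ⁅commutator G, commutator G⁆
  · exact ⟨_, le_rfl, le_rfl, h⟩
  · push Not at h
    obtain ⟨t, y, hty⟩ : ∃ t y : G, ⁅t, y⁆ ∉ ⁅commutator G, commutator G⁆ := by
      by_contra! h2
      refine hG (le_antisymm ?_ (Subgroup.commutator_le_left _ _))
      rw [commutator_def, Subgroup.commutator_le]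
      intro a _ b _
      exact h2 a b
    exact ⟨commutator G ⊔ Subgroup.zpowers y, le_sup_left,
      Subgroup.commutator_sup_zpowers_le _ _ h y, t, y,
      le_sup_right (a := commutator G) (Subgroup.mem_zpowers y), hty⟩

/-- If the derived subgroup is not perfect, then there are a proper subgroup `B` containing it and
a linear character of `B` of prime power order that, for each prime `q` dividing the index, is
moved by some `t` with `t ^ q ∈ B`. -/
theorem exists_linear_character_moved_of_prime_dvd_index [Finite G]
    (hG : commutator G ≠ ⁅commutator G, commutator G⁆) :
    ∃ B : Subgroup G, commutator G ≤ B ∧ B ≠ ⊤ ∧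
      ∃ (l : B →* ℂˣ) (r k : ℕ), r.Prime ∧ (∀ b, l b ^ r ^ k = 1) ∧
        ∀ q : ℕ, q.Prime → q ∣ B.index →
          ∃ t : G, t ^ q ∈ B ∧ ∃ b b' : B, (b' : G) = t * b * t⁻¹ ∧ l b' ≠ l b := by
  obtain ⟨B, ⟨hB, l, t, b, b', hb, hl⟩, hmax⟩ :=
    WellFounded.has_min (wellFounded_gt (α := Subgroup G))
      {B | commutator G ≤ B ∧
        ∃ (l : B →* ℂˣ) (t : G) (b b' : B), (b' : G) = t * b * t⁻¹ ∧ l b' ≠ l b}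
      (exists_moved_linear_character hG)
  have hcn : l b' / l b ≠ 1 := fun e => hl (div_eq_one.1 e)
  have hln : ∀ b, l b ^ Nat.card G = 1 := fun b => by
    rw [← map_pow, show b ^ Nat.card G = 1 from Subtype.ext (by simp), map_one]
  have hn0 : Nat.card G ≠ 0 := Nat.card_pos.ne'
  -- With `|G| = r ^ k * m` and `r ∤ m`, the power `l ^ m` has `r`-power order. It is still moved by
  -- `t`, because `r` divides the order of `l b' / l b`.
  obtain ⟨r, hr, hrd⟩ := Nat.exists_prime_and_dvd (mt orderOf_eq_one_iff.1 hcn)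
  obtain ⟨k, m, hrm, hkm⟩ := Nat.exists_eq_pow_mul_and_not_dvd hn0 r hr.ne_one
  have hl' : (l b') ^ m ≠ (l b) ^ m := fun e => hrm (hrd.trans (orderOf_dvd_of_pow_eq_one (by
    rw [div_pow, e, div_self'])))
  refine ⟨B, hB, ?_, l ^ m, r, k, hr, fun b => ?_, fun q hq hqB => ?_⟩
  · rintro rfl
    apply hl
    rw [show b' = ⟨t, Subgroup.mem_top t⟩ * b * ⟨t, Subgroup.mem_top t⟩⁻¹ from Subtype.ext hb,
      map_mul, map_mul, map_inv, mul_right_comm, mul_inv_cancel, one_mul]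
  · rw [MonoidHom.pow_apply, ← pow_mul, mul_comm, ← hkm, hln]
  · have hBn : B.Normal := ⟨fun x hx g => Subgroup.conj_mem_of_commutator_le hB g hx⟩
    have : Fact q.Prime := ⟨hq⟩
    obtain ⟨x, hx⟩ := exists_prime_orderOf_dvd_card' (G := G ⧸ B) q hqB
    obtain ⟨y, rfl⟩ := QuotientGroup.mk_surjective x
    have hyB : y ∉ B := fun h => by
      rw [(QuotientGroup.eq_one_iff y).2 h, orderOf_one] at hx
      exact hq.one_lt.ne hx
    refine ⟨y, ?_, ?_⟩
    · rw [← QuotientGroup.eq_one_iff, QuotientGroup.mk_pow, ← hx, pow_orderOf_eq_one]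
    -- If `y` fixed `l ^ m`, this character would extend to `B⟨y⟩`, and the extension would still be
    -- moved by `t`, against the maximality of `B`.
    · by_contra! hinv
      let T : Subgroup G :=
        -- `T` is the stabilizer of `l ^ m` in `G`.
        { carrier := {g | ∀ c c' : B, (c' : G) = g * c * g⁻¹ → (l ^ m) c' = (l ^ m) c}
          one_mem' := fun c c' h => by rw [show c' = c from Subtype.ext (by simpa using h)]
          mul_mem' := fun {g h} hg hh c c' e => by
            rw [hg ⟨_, hBn.conj_mem c c.2 h⟩ c' (by simp [e, mul_assoc]), hh c _ rfl]
          inv_mem' := fun {g} hg c c' e => (hg c' c (by simp [e, mul_assoc])).symm }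
      have hBT : B ≤ T := fun x hx c c' e => by
        rw [show c' = ⟨x, hx⟩ * c * ⟨x, hx⟩⁻¹ from Subtype.ext e,
          map_mul, map_mul, map_inv, mul_right_comm, mul_inv_cancel, one_mul]
      let S := B ⊔ Subgroup.zpowers y
      have hST : S ≤ T := sup_le hBT (by rw [Subgroup.zpowers_le]; exact hinv)
      have hBS : B ≤ S := le_sup_left
      have hyS : y ∈ S := le_sup_right (a := B) (Subgroup.mem_zpowers y)
      have htop : B.subgroupOf S ⊔ Subgroup.zpowers (⟨y, hyS⟩ : S) = ⊤ := by
        apply Subgroup.map_injective S.subtype_injective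
        rw [Subgroup.map_sup, Subgroup.map_subgroupOf_eq_of_le hBS, MonoidHom.map_zpowers,
          ← MonoidHom.range_eq_map, Subgroup.range_subtype]
        rfl
      obtain ⟨L, hL⟩ := MonoidHom.exists_extension_of_sup_zpowers_eq_top htop
        ((l ^ m).comp (Subgroup.subgroupOfEquivOfLe hBS).toMonoidHom) fun g c =>
          ⟨⟨g * c * g⁻¹, hBn.conj_mem c c.2 g⟩, rfl, hST g.2 _ _ rfl⟩
      refine hmax S ⟨hB.trans hBS, L, t, ⟨b, hBS b.2⟩, ⟨b', hBS b'.2⟩, hb, ?_⟩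
        (lt_of_le_of_ne hBS fun e => hyB (e ▸ hyS))
      have h1 := hL ⟨⟨b, hBS b.2⟩, b.2⟩
      have h2 := hL ⟨⟨b', hBS b'.2⟩, b'.2⟩
      exact fun e => hl' (h2.symm.trans (e.trans h1))

end GroupTheory

/-! ### Twists by linear characters -/

namespace Representation

section

variable {k B W : Type*} [Field k] [Group B] [AddCommGroup W] [Module k W]

/-- The twist of a representation by a linear character. -/
def twist (σ : Representation k B W) (l : B →* kˣ) : Representation k B W where
  toFun b := (l b : k) • σ b
  map_one' := by simp
  map_mul' a b := by ext; simp [smul_smul, mul_comm]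

@[simp]
theorem twist_apply (σ : Representation k B W) (l : B →* kˣ) (b : B) (w : W) :
    σ.twist l b w = (l b : k) • σ b w := rfl

theorem IsIrreducible.twist {σ : Representation k B W} (h : σ.IsIrreducible) (l : B →* kˣ) :
    (σ.twist l).IsIrreducible := by
  refine (isIrreducible_iff_forall_submodule _).2 ⟨h.nontrivial, fun U hU =>
    h.eq_bot_or_eq_top_of_invariant fun g v hv => ?_⟩
  have := hU g v hv
  rwa [twist_apply, Submodule.smul_mem_iff _ (l g).ne_zero] at this

theorem isIrreducible_self (σ : Representation k B k) : σ.IsIrreducible :=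
  (isIrreducible_iff_forall_submodule _).2 ⟨inferInstance, fun U _ => eq_bot_or_eq_top U⟩

/-- If both `σ` and its twist by `l` are invariant under `τ`, then `l` is invariant under `τ` up to
roots of unity of order `dim σ`. -/
theorem pow_finrank_eq_of_invariant [FiniteDimensional k W] {σ : Representation k B W} {l : B →* kˣ}
    {τ : B → B} {T₁ T₂ : W ≃ₗ[k] W} (h₁ : ∀ b w, T₁ (σ b w) = σ (τ b) (T₁ w))
    (h₂ : ∀ b w, T₂ (σ.twist l b w) = σ.twist l (τ b) (T₂ w)) (b : B) :
    l (τ b) ^ finrank k W = l b ^ finrank k W := by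
  -- Invariance under `τ` passes to determinants, and twisting by `l` multiplies the determinant by
  -- `l ^ dim W`.
  have hdet : ∀ {ρ : Representation k B W} {T : W ≃ₗ[k] W},
      (∀ b w, T (ρ b w) = ρ (τ b) (T w)) → LinearMap.det (ρ (τ b)) = LinearMap.det (ρ b) := by
    intro ρ T hT
    rw [← LinearMap.det_conj (ρ b) T]
    congr 1
    ext w
    simp [hT]
  have h3 := hdet h₂
  change LinearMap.det ((l (τ b) : k) • σ (τ b)) = LinearMap.det ((l b : k) • σ b) at h3
  rw [LinearMap.det_smul, LinearMap.det_smul, hdet h₁] at h3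
  have h0 : LinearMap.det (σ b) ≠ 0 := fun e => by
    have : LinearMap.det (σ b) * LinearMap.det (σ b⁻¹) = 1 := by
      rw [← map_mul, ← map_mul, mul_inv_cancel, map_one, map_one]
    simp [e] at this
  have := mul_right_cancel₀ h0 h3
  ext
  exact_mod_cast this

end

end Representation

/-! ### Character degrees as dimensions of irreducible representations -/

namespace CharacterPrimeGraph

variable {G : Type*} [Group G]

/-- Choosing a basis moves the action to some `ℂⁿ`, the only spaces admitted in `Irr`. -/
theorem finrank_mem_cd {V : Type*} [AddCommGroup V] [Module ℂ V] [FiniteDimensional ℂ V]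
    {ρ : Representation ℂ G V} (h : ρ.IsIrreducible) : finrank ℂ V ∈ cd G := by
  let e : V ≃ₗ[ℂ] (Fin (finrank ℂ V) → ℂ) := (finBasis ℂ V).equivFun
  let φ : Representation ℂ G (Fin (finrank ℂ V) → ℂ) :=
    { toFun := fun g => e.conj (ρ g)
      map_one' := by ext; simp [LinearEquiv.conj_apply]
      map_mul' := fun a b => by
        ext; simp [LinearEquiv.conj_apply] }
  have hφ : ∀ g v, φ g (e v) = e (ρ g v) := fun g v => by
    change e.conj (ρ g) (e v) = _
    simp [LinearEquiv.conj_apply]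
  refine ⟨φ.character, ⟨_, φ, ?_, rfl⟩, by simp⟩
  have := h.nontrivial
  refine (Representation.isIrreducible_iff_forall_submodule _).2
    ⟨e.symm.toEquiv.nontrivial, fun U hU => ?_⟩
  rcases h.eq_bot_or_eq_top_of_invariant (U := U.comap e.toLinearMap) (fun g v hv => by
    have := hU g _ hv
    rwa [Submodule.mem_comap, LinearEquiv.coe_coe, ← hφ]) with h1 | h1
  · left
    rw [Submodule.eq_bot_iff] at h1 ⊢
    intro x hx
    obtain ⟨v, rfl⟩ := e.surjective x
    rw [h1 v hx, map_zero]
  · right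
    rw [Submodule.eq_top_iff'] at h1 ⊢
    intro x
    obtain ⟨v, rfl⟩ := e.surjective x
    exact h1 v

theorem exists_irreducible_of_mem_cd {a : ℕ} (ha : a ∈ cd G) :
    ∃ ρ : Representation ℂ G (Fin a → ℂ), ρ.IsIrreducible := by
  obtain ⟨_, ⟨n, φ, hφ, rfl⟩, h⟩ := ha
  have : n = a := by simpa using h
  exact this ▸ ⟨φ, hφ⟩

theorem eq_one_of_mem_cd [IsMulCommutative G] {a : ℕ} (ha : a ∈ cd G) : a = 1 := by
  obtain ⟨ρ, hρ⟩ := exists_irreducible_of_mem_cd ha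
  have := Representation.IsIrreducible.finrank_eq_one_of_isMulCommutative ρ
  simpa using this

end CharacterPrimeGraph

/-! ### Adjacency in the prime graph, and the prism -/

namespace CharacterPrimeGraph

/-- If the derived subgroup of `G` is not perfect, there are primes `p ∈ ρ(G)` and `r` such that
each prime divisor other than `p` of a character degree prime to `r` is adjacent to `p`. -/
theorem exists_prime_mul_dvd_of_not_dvd {G : Type*} [Group G] [Finite G]
    (hG : commutator G ≠ ⁅commutator G, commutator G⁆) :
    ∃ p ∈ rho G, ∃ r : ℕ, r.Prime ∧ ∀ a ∈ cd G, ∀ q : ℕ, q.Prime → q ≠ p → q ∣ a → ¬ r ∣ a →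
      ∃ c ∈ cd G, p * q ∣ c := by
  obtain ⟨B, hB, hBtop, l, r, k, hr, hlr, hmoved⟩ :=
    exists_linear_character_moved_of_prime_dvd_index hG
  have hs' : ∀ t : G, ∀ b : B, ((⟨_, Subgroup.conj_mem_of_commutator_le hB t b.2⟩ : B) : G) =
    t * b * t⁻¹ := fun _ _ => rfl
  obtain ⟨p, hp, hpB⟩ := Nat.exists_prime_and_dvd (mt Subgroup.index_eq_one.1 hBtop)
  -- a representation over the linear character itself
  have hσ := (Representation.isIrreducible_self (Representation.trivial ℂ B ℂ)).twist l
  obtain ⟨V, ρ, f, hρ, hf, hfi⟩ := hσ.exists_over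
  -- One representation over `l` serves all primes dividing the index, since `l` is moved by an
  -- element belonging to each of them.
  have hdvd : ∀ q : ℕ, q.Prime → q ∣ B.index → q ∣ finrank ℂ V := by
    intro q hq hqB
    obtain ⟨t, ht, b, b', hb, hl⟩ := hmoved q hq hqB
    have := hσ.mul_finrank_dvd hB hq ht (hs' t) (fun T => ⟨b, 1, fun e => hl ?_⟩) hρ hf hfi
    · rwa [finrank_self, mul_one] at this
    · have hb' : (⟨_, Subgroup.conj_mem_of_commutator_le hB t b.2⟩ : B) = b' := Subtype.ext hb.symm
      rw [hb', Representation.twist_apply, Representation.twist_apply,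
        Representation.trivial_apply, Representation.trivial_apply, map_smul] at e
      ext
      exact (mul_right_cancel₀ (T.map_ne_zero_iff.2 one_ne_zero) e).symm
  refine ⟨p, ⟨hp, _, finrank_mem_cd hρ, hdvd p hp hpB⟩, r, hr, fun a ha q hq hqp hqa hra => ?_⟩
  by_cases hqB : q ∣ B.index
  · exact ⟨_, finrank_mem_cd hρ, Nat.Coprime.mul_dvd_of_dvd_of_dvd
      ((Nat.coprime_primes hp hq).2 hqp.symm) (hdvd p hp hpB) (hdvd q hq hqB)⟩
  obtain ⟨φ, hφ⟩ := exists_irreducible_of_mem_cd ha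
  have := hφ.nontrivial
  -- an irreducible constituent of the restriction to `B`
  obtain ⟨W, hW, hWirr, -, π, hπ0, hπ⟩ := Representation.exists_irreducible_not_le_ker
    (φ.comp B.subtype) (f := LinearMap.id)
    (fun e => by
      obtain ⟨x, hx⟩ := exists_ne (0 : Fin a → ℂ)
      exact hx (LinearMap.congr_fun e x))
  obtain ⟨m, hm, ham⟩ := hWirr.exists_dvd_index_finrank_eq_mul B.subtype
    (by rwa [B.range_subtype]) hφ hπ0 hπ
  rw [B.range_subtype] at hm
  rw [finrank_fin_fun] at ham
  have hqW : q ∣ finrank ℂ W := ((hq.dvd_mul.1 (ham ▸ hqa)).resolve_left fun h =>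
    hqB (h.trans hm))
  have hrW : ¬ r ∣ finrank ℂ W := fun h => hra (ham ▸ h.mul_left m)
  set σ := Representation.onInvariant (φ.comp B.subtype) W hW
  obtain ⟨t, ht, b, b', hb, hl⟩ := hmoved p hp hpB
  -- an irreducible representation of the same dimension not fixed by `t`
  obtain ⟨τ, hτ, hτt⟩ : ∃ τ : Representation ℂ B W, τ.IsIrreducible ∧ ∀ T : W ≃ₗ[ℂ] W,
      ∃ b w, T (τ b w) ≠ τ ⟨_, Subgroup.conj_mem_of_commutator_le hB t b.2⟩ (T w) := by
    -- If `σ` and `σ ⊗ l` were both invariant under `t`, then `(l b' / l b) ^ dim W = 1`. This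
    -- quotient also has `r`-power order while `r ∤ dim W`, so it would be `1`.
    by_contra! h
    obtain ⟨T₁, h₁⟩ := h σ hWirr
    obtain ⟨T₂, h₂⟩ := h (σ.twist l) (hWirr.twist l)
    have h3 := Representation.pow_finrank_eq_of_invariant
      (τ := fun b => ⟨_, Subgroup.conj_mem_of_commutator_le hB t b.2⟩) h₁ h₂ b
    rw [show (⟨_, Subgroup.conj_mem_of_commutator_le hB t b.2⟩ : B) = b' from
      Subtype.ext hb.symm] at h3
    have h4 : (l b' / l b) ^ finrank ℂ W = 1 := by rw [div_pow, h3, div_self']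
    have h5 : (l b' / l b) ^ r ^ k = 1 := by rw [div_pow, hlr, hlr, div_self']
    have h6 : Nat.gcd (finrank ℂ W) (r ^ k) = 1 :=
      (((Nat.Prime.coprime_iff_not_dvd hr).2 hrW).pow_left k).symm
    have h7 := Nat.dvd_gcd (orderOf_dvd_of_pow_eq_one h4) (orderOf_dvd_of_pow_eq_one h5)
    rw [h6, Nat.dvd_one, orderOf_eq_one_iff] at h7
    exact hl (div_eq_one.1 h7)
  obtain ⟨V', ρ', f', hρ', hf', hfi'⟩ := hτ.exists_over
  exact ⟨_, finrank_mem_cd hρ', (mul_dvd_mul_left p hqW).trans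
    (hτ.mul_finrank_dvd hB hp ht (hs' t) hτt hρ' hf' hfi')⟩

/-- Vertices of one triangle share the quotient by `3`, and the ends of a connecting edge share the
remainder; this form lets `decide` settle `prismGraph_exists_edge`. -/
theorem prismGraph_adj_iff (x y : Fin 6) :
    prismGraph.Adj x y ↔ x ≠ y ∧ (x.val / 3 = y.val / 3 ∨ x.val % 3 = y.val % 3) := by
  simp only [prismGraph, SimpleGraph.fromEdgeSet_adj, Set.mem_insert_iff, Set.mem_singleton_iff]
  revert x y
  decide

/-- For all vertices `v` and `r` of the prism, some edge has an end not in the closed neighbourhood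
of `v` and is not contained in the closed neighbourhood of `r`. -/
theorem prismGraph_exists_edge (v r : Fin 6) :
    ∃ x y, prismGraph.Adj x y ∧ x ≠ v ∧ ¬ prismGraph.Adj v x ∧
      ¬ ((r = x ∨ prismGraph.Adj r x) ∧ (r = y ∨ prismGraph.Adj r y)) := by
  simp only [prismGraph_adj_iff]
  revert v r
  decide

theorem commutator_eq_of_primeGraph_iso_prismGraph {G : Type*} [Group G] [Finite G]
    (e : primeGraph G ≃g prismGraph) : commutator G = ⁅commutator G, commutator G⁆ := by
  by_contra hG
  obtain ⟨p, hp, r, hr, h⟩ := exists_prime_mul_dvd_of_not_dvd hG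
  have key : ∀ x y : Fin 6, prismGraph.Adj x y → x ≠ e ⟨p, hp⟩ → ¬ prismGraph.Adj (e ⟨p, hp⟩) x →
      ∃ hr : r ∈ rho G, (e ⟨r, hr⟩ = x ∨ prismGraph.Adj (e ⟨r, hr⟩) x) ∧
        (e ⟨r, hr⟩ = y ∨ prismGraph.Adj (e ⟨r, hr⟩) y) := by
    intro x y hxy hxp hpx
    obtain ⟨x, rfl⟩ := e.surjective x
    obtain ⟨y, rfl⟩ := e.surjective y
    rw [e.map_adj_iff] at hxy hpx
    obtain ⟨-, a, ha, hxya⟩ := hxy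
    have hxp' : (x : ℕ) ≠ p := fun e' => hxp (congrArg e (Subtype.ext e'))
    have hxa := (dvd_mul_right (x : ℕ) y).trans hxya
    have hya := (dvd_mul_left (y : ℕ) x).trans hxya
    -- Otherwise `x`, a prime divisor of a degree prime to `r`, would be adjacent to `p`.
    have hra : r ∣ a := by
      by_contra hra
      exact hpx ⟨fun e' => hxp' (congrArg Subtype.val e').symm, h a ha x x.2.1 hxp' hxa hra⟩
    refine ⟨⟨hr, a, ha, hra⟩, ?_⟩
    have hadj : ∀ z : rho G, (z : ℕ) ∣ a → (e ⟨r, hr, a, ha, hra⟩ = e z ∨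
        prismGraph.Adj (e ⟨r, hr, a, ha, hra⟩) (e z)) := by
      intro z hz
      by_cases hrz : r = z
      · exact Or.inl (congrArg e (Subtype.ext hrz))
      · exact Or.inr (e.map_adj_iff.2 ⟨fun e' => hrz (congrArg Subtype.val e'), a, ha,
          Nat.Coprime.mul_dvd_of_dvd_of_dvd ((Nat.coprime_primes hr z.2.1).2 hrz) hra hz⟩)
    exact ⟨hadj x hxa, hadj y hya⟩
  -- The vertex `0` is arbitrary: this use of `key` only shows that `r` is a vertex of the graph, so
  -- that the edge can next be chosen relative to `r`.
  obtain ⟨x, y, h1, h2, h3, -⟩ := prismGraph_exists_edge (e ⟨p, hp⟩) 0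
  obtain ⟨hrρ, -⟩ := key x y h1 h2 h3
  obtain ⟨x, y, h1, h2, h3, h4⟩ := prismGraph_exists_edge (e ⟨p, hp⟩) (e ⟨r, hrρ⟩)
  obtain ⟨_, h5⟩ := key x y h1 h2 h3
  exact h4 h5

theorem rho_eq_empty_of_commutator_eq_bot {G : Type*} [Group G] (h : commutator G = ⊥) :
    rho G = ∅ := by
  have : IsMulCommutative G := ⟨⟨fun a b => by
    have := Subgroup.commutator_eq_bot_iff_le_centralizer.1 h (Subgroup.mem_top b)
    exact (Subgroup.mem_centralizer_iff.1 this a (Subgroup.mem_top a))⟩⟩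
  refine Set.eq_empty_of_forall_notMem fun p ⟨hp, a, ha, hpa⟩ => ?_
  rw [eq_one_of_mem_cd ha, Nat.dvd_one] at hpa
  exact hp.ne_one hpa

end CharacterPrimeGraph

theorem mainTheorem7 (G : Type*) [Group G] [Finite G]
    (h : Nonempty (CharacterPrimeGraph.primeGraph G ≃g CharacterPrimeGraph.prismGraph)) :
    commutator G = ⁅commutator G, commutator G⁆ ∧ ¬ Group.IsSolvable G := by
  obtain ⟨e⟩ := h
  have hG := CharacterPrimeGraph.commutator_eq_of_primeGraph_iso_prismGraph e
  refine ⟨hG, fun hsol => ?_⟩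
  have hbot : commutator G = ⊥ := by
    by_contra hne
    exact (Group.isSolvable_iff_commutator_lt.1 hsol _ hne).ne hG.symm
  have hempty := CharacterPrimeGraph.rho_eq_empty_of_commutator_eq_bot hbot
  exact (Set.eq_empty_iff_forall_notMem.1 hempty) _ (e.symm 0).2
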